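/- Let $X$ be a (Hausdorff) complex manifold of dimension $n$ and let $\Omega\subset X$ be a relatively compact domain (a nonempty connected open set) with smooth boundary $b\Omega$; that is, near each boundary point $\Omega$ is the set $\{r<0\}$ for a smooth real function $r$ with $dr\neq 0$. Assume that $\Omega$ is Andreotti pseudoconcave: every $q\in b\Omega$ has a fundamental system of open neighborhoods $U$ such that $q$ is an interior point of $$\widehat{(U\cap\Omega)}_U=\Bigl\{p\in U:\ |f(p)|\le \sup_{z\in U\cap\Omega}|f(z)|\ \text{ for all } f\in\mathcal O(U)\Bigr\}.$$ Let $E$ be a holomorphic line bundle over $\overline\Omega$, that is, a line bundle given by a covering of $\overline\Omega$ by open subsets $U_i$ of $X$ and by zero-free transition functions $g_{ij}$ on $\overline\Omega\cap U_i\cap U_j$ that satisfy the cocycle condition, are holomorphic in $\Omega$ and are smooth up to $b\Omega$ (for instance, the restriction of a holomorphic line bundle on a neighborhood of $\overline\Omega$). Then there is a constant $C$, depending only on $\Omega$ and $E$, such that for every integer $k\ge 1$ the space of holomorphic sections of the $k$-th tensor power $E^k$ over $\Omega$ is finite-dimensional and its dimension $h^0(\Omega,E^k)$ satisfies $$h^0(\Omega,E^k)\le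 C\,k^n .$$ -/

import Mathlib

open scoped Manifold ContDiff

/-- The model space `ℂⁿ` of an `n`-dimensional complex manifold. -/
abbrev CModel (n : ℕ) : Type := EuclideanSpace ℂ (Fin n)

section

variable {n : ℕ} {X : Type*} [TopologicalSpace X] [ChartedSpace (CModel n) X]

/-- `f` is a holomorphic function on `U` (used for open `U`). The values of `f` off `U` are
irrelevant. -/
def HolomorphicOn (n : ℕ) {X : Type*} [TopologicalSpace X] [ChartedSpace (CModel n) X]
    (f : X → ℂ) (U : Set X) : Prop :=
  MDifferentiableOn 𝓘(ℂ, CModel n) 𝓘(ℂ, ℂ) f U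

/-- The hull of `U ∩ Ω` in `U`: the points `p ∈ U` with `|f(p)| ≤ sup_{U ∩ Ω} |f|` for every
holomorphic function `f` on `U`. The supremum is taken in `[0, ∞]`. -/
def holHull (n : ℕ) {X : Type*} [TopologicalSpace X] [ChartedSpace (CModel n) X]
    (U Ω : Set X) : Set X :=
  {p | p ∈ U ∧ ∀ f : X → ℂ, HolomorphicOn n f U → ‖f p‖ₑ ≤ ⨆ z ∈ U ∩ Ω, ‖f z‖ₑ}

/-- `q` is an Andreotti pseudoconcave point for `Ω`: it has a fundamental system `𝒰` of open
neighbourhoods `U` for which `q` is an interior point of the hull of `U ∩ Ω` in `U`. -/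
def IsPseudoconcavePoint (n : ℕ) {X : Type*} [TopologicalSpace X] [ChartedSpace (CModel n) X]
    (Ω : Set X) (q : X) : Prop :=
  ∃ 𝒰 : Set (Set X),
    (∀ U ∈ 𝒰, IsOpen U ∧ q ∈ U) ∧
    (∀ V ∈ nhds q, ∃ U ∈ 𝒰, U ⊆ V) ∧
    ∀ U ∈ 𝒰, q ∈ interior (holHull n U Ω)

/-- `Ω` is Andreotti pseudoconcave: each of its boundary points is. -/
def IsAndreottiPseudoconcave (n : ℕ) {X : Type*} [TopologicalSpace X]
    [ChartedSpace (CModel n) X] (Ω : Set X) : Prop :=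
  ∀ q ∈ frontier Ω, IsPseudoconcavePoint n Ω q

/-- `Ω` has (real) smooth boundary: near each boundary point, `Ω` is the sublevel set `r < 0` of
a smooth real function `r` with nowhere vanishing differential. -/
def HasSmoothBoundary (n : ℕ) {X : Type*} [TopologicalSpace X] [ChartedSpace (CModel n) X]
    (Ω : Set X) : Prop :=
  ∀ q ∈ frontier Ω, ∃ (U : Set X) (r : X → ℝ), IsOpen U ∧ q ∈ U ∧
    ContMDiffOn 𝓘(ℝ, CModel n) 𝓘(ℝ, ℝ) ∞ r U ∧
    (∀ x ∈ U, mfderiv 𝓘(ℝ, CModel n) 𝓘(ℝ, ℝ) r x ≠ 0) ∧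
    ∀ x ∈ U, x ∈ Ω ↔ r x < 0

/-- A holomorphic line bundle over the closure of `Ω`, i.e. a holomorphic line bundle over `Ω`
that extends smoothly to the boundary, given by its transition functions `g i j` with respect to
local frames `σ i` over `cover i` (`σ i = g i j • σ j`): they are defined on
`closure Ω ∩ cover i ∩ cover j`, are smooth up to the boundary, holomorphic in `Ω`, zero-free and
satisfy the cocycle condition. Values of `g i j` elsewhere are irrelevant. A line bundle that is
holomorphic on a neighbourhood of `closure Ω` is a special case. -/
structure ClosureLineBundle (n : ℕ) {X : Type*} [TopologicalSpace X] [ChartedSpace (CModel n) X]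
    (Ω : Set X) (ι : Type*) where
  cover : ι → Set X
  isOpen_cover : ∀ i, IsOpen (cover i)
  closure_subset : closure Ω ⊆ ⋃ i, cover i
  g : ι → ι → X → ℂ
  smooth_g : ∀ i j, ContMDiffOn 𝓘(ℝ, CModel n) 𝓘(ℝ, ℂ) ∞ (g i j)
    (closure Ω ∩ (cover i ∩ cover j))
  holomorphic_g : ∀ i j, HolomorphicOn n (g i j) (Ω ∩ (cover i ∩ cover j))
  g_ne_zero : ∀ i j, ∀ x ∈ closure Ω ∩ (cover i ∩ cover j), g i j x ≠ 0
  cocycle : ∀ i j l, ∀ x ∈ closure Ω ∩ (cover i ∩ cover j ∩ cover l),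
    g i j x * g j l x = g i l x

namespace ClosureLineBundle

variable {Ω : Set X} {ι : Type*}

/-- The tensor power `E ^ k`: the transition functions are raised to the power `k`. -/
def tensorPow (E : ClosureLineBundle n Ω ι) (k : ℕ) : ClosureLineBundle n Ω ι where
  cover := E.cover
  isOpen_cover := E.isOpen_cover
  closure_subset := E.closure_subset
  g i j x := E.g i j x ^ k
  smooth_g i j := (contDiff_id.pow k).contMDiff.comp_contMDiffOn (E.smooth_g i j)
  holomorphic_g i j :=
    (differentiable_id.pow k).mdifferentiable.comp_mdifferentiableOn (E.holomorphic_g i j)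
  g_ne_zero i j x hx := pow_ne_zero k (E.g_ne_zero i j x hx)
  cocycle i j l x hx := by rw [← mul_pow, E.cocycle i j l x hx]

/-- The space of holomorphic sections of `E` over `Ω`. A section is given by its components
`s i` with respect to the frames `σ i`: holomorphic functions on `Ω ∩ cover i` that are related
by `s j = s i * g i j`. The components are extended by zero to all of `X`, so that a section
determines its family of components. -/
def sections (E : ClosureLineBundle n Ω ι) : Submodule ℂ (ι → X → ℂ) where
  carrier := {s | (∀ i, HolomorphicOn n (s i) (Ω ∩ E.cover i)) ∧
    (∀ i j, ∀ x ∈ Ω ∩ (E.cover i ∩ E.cover j), s j x = s i x * E.g i j x) ∧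
    ∀ i, ∀ x ∉ Ω ∩ E.cover i, s i x = 0}
  add_mem' {s t} hs ht := by
    refine ⟨fun i => (hs.1 i).add (ht.1 i), fun i j x hx => ?_, fun i x hx => ?_⟩
    · simp only [Pi.add_apply, hs.2.1 i j x hx, ht.2.1 i j x hx, add_mul]
    · simp only [Pi.add_apply, hs.2.2 i x hx, ht.2.2 i x hx, add_zero]
  zero_mem' := by
    refine ⟨fun i => mdifferentiableOn_const, fun i j x hx => ?_, fun i x hx => rfl⟩
    simp
  smul_mem' c s hs := by
    refine ⟨fun i => (hs.1 i).const_smul c, fun i j x hx => ?_, fun i x hx => ?_⟩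
    · simp only [Pi.smul_apply, smul_eq_mul, hs.2.1 i j x hx, mul_assoc]
    · simp only [Pi.smul_apply, hs.2.2 i x hx, smul_zero]

end ClosureLineBundle

end

/-! This is Siegel's argument: a section of `E ^ k` that vanishes to order about `k` at finitely
many fixed points is zero. Its jets there therefore determine it, and jets of order `O(k)` in `n`
variables form a space of dimension `O(k ^ n)`.

Pseudoconcavity replaces compactness. By `exists_isCompact_bound_of_isPseudoconcavePoint`, a
holomorphic function on `Ω` is bounded near a boundary point by its maximum on a compact subset of
`Ω`. So a section is controlled on all of `Ω` by its values on finitely many coordinate balls, and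
changing frames over compact subsets of `Ω` costs a factor `C ^ k`. If the jets at the centres
vanish to order `m * k + 1`, then `norm_le_of_jet_eq_zero` gains `2 ^ (-(m * k + 1))` in passing to
balls of half the radius. This beats `C ^ k` once `2 ^ m > C`, so every bound improves to half of
itself and the section is zero.

The hull condition concerns functions holomorphic across the boundary, which sections are not. In
`exists_compact_bound_near` functions are translated inward until they are holomorphic on a full
neighbourhood, and the identity obtained there is continued analytically back. -/

/-! ### Taylor polynomials along complex lines and the Schwarz lemma. -/

open Metric Set Filter Topology in
/-- Directional derivatives of holomorphic functions are holomorphic. -/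
theorem differentiableOn_fderiv_apply {n : ℕ} {f : CModel n → ℂ} {U : Set (CModel n)}
    (hU : IsOpen U) (hf : DifferentiableOn ℂ f U) (v : CModel n) :
    DifferentiableOn ℂ (fun x => fderiv ℂ f x v) U := by
  intro x₀ hx₀
  apply DifferentiableAt.differentiableWithinAt
  -- The derivative is written as a Cauchy integral of `f` over a small circle in the direction `v`,
  -- and this integral is differentiated in `x`. A bound for `f` on the ball of radius `3 * r`
  -- bounds `fderiv` on that of radius `2 * r`, which contains the circles.
  obtain ⟨r, hr, hrU⟩ : ∃ r > 0, closedBall x₀ (3 * r) ⊆ U := by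
    obtain ⟨r, hr, h⟩ := nhds_basis_closedBall.mem_iff.1 (hU.mem_nhds hx₀)
    exact ⟨r / 3, by positivity, by rwa [mul_div_cancel₀ _ (by norm_num : (3 : ℝ) ≠ 0)]⟩
  obtain ⟨M, hM⟩ := (isCompact_closedBall x₀ (3 * r)).exists_bound_of_continuousOn
    (hf.continuousOn.mono hrU)
  have hdiff : ∀ y ∈ ball x₀ (3 * r), DifferentiableAt ℂ f y := fun y hy =>
    hf.differentiableAt (hU.mem_nhds (hrU (ball_subset_closedBall hy)))
  have hbound : ∀ y ∈ ball x₀ (2 * r), ‖fderiv ℂ f y‖ ≤ (M + M) / r := by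
    intro y hy
    have hsub : ball y r ⊆ ball x₀ (3 * r) := ball_subset_ball' (by
      rw [mem_ball] at hy; linarith)
    refine Complex.norm_fderiv_le_div_of_mapsTo_ball
      (fun z hz => (hdiff z (hsub hz)).differentiableWithinAt) (fun z hz => ?_) hr
    rw [mem_closedBall, dist_eq_norm]
    exact (norm_sub_le _ _).trans (add_le_add (hM _ (ball_subset_closedBall (hsub hz)))
      (hM _ (ball_subset_closedBall (hsub (mem_ball_self hr)))))
  obtain ⟨ε, hε, hεv⟩ : ∃ ε > 0, ε * ‖v‖ < r := by
    refine ⟨r / (‖v‖ + 1), by positivity, ?_⟩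
    rw [div_mul_eq_mul_div, div_lt_iff₀ (by positivity)]
    nlinarith [norm_nonneg v]
  have hmem : ∀ x ∈ ball x₀ r, ∀ ζ ∈ closedBall (0 : ℂ) ε, x + ζ • v ∈ ball x₀ (2 * r) := by
    intro x hx ζ hζ
    rw [mem_ball, dist_eq_norm] at hx ⊢
    rw [mem_closedBall, dist_zero_right] at hζ
    calc ‖x + ζ • v - x₀‖ = ‖(x - x₀) + ζ • v‖ := by congr 1; abel
      _ ≤ ‖x - x₀‖ + ‖ζ‖ * ‖v‖ := (norm_add_le _ _).trans (by rw [norm_smul])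
      _ < r + r := add_lt_add_of_lt_of_le hx
          ((mul_le_mul_of_nonneg_right hζ (norm_nonneg _)).trans hεv.le)
      _ = 2 * r := by ring
  have hsub23 : ball x₀ (2 * r) ⊆ ball x₀ (3 * r) := ball_subset_ball (by linarith)
  have hcauchy : ∀ x ∈ ball x₀ r, fderiv ℂ f x v =
      (2 * Real.pi * Complex.I : ℂ)⁻¹ • ∮ ζ in C(0, ε), (1 / (ζ - 0) ^ 2) • f (x + ζ • v) := by
    intro x hx
    have hline : ∀ ζ ∈ closedBall (0 : ℂ) ε,
        HasDerivAt (fun ζ : ℂ => f (x + ζ • v)) (fderiv ℂ f (x + ζ • v) v) ζ := by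
      intro ζ hζ
      have h1 : HasDerivAt (fun ζ : ℂ => x + ζ • v) v ζ := by
        simpa using ((hasDerivAt_id ζ).smul_const v).const_add x
      exact (hdiff _ (hsub23 (hmem x hx ζ hζ))).hasFDerivAt.comp_hasDerivAt ζ h1
    rw [DifferentiableOn.deriv_eq_smul_circleIntegral hε
      (fun ζ hζ => (hline ζ hζ).differentiableAt.differentiableWithinAt),
      (hline 0 (mem_closedBall_self hε.le)).deriv, smul_smul,
      inv_mul_cancel₀ Complex.two_pi_I_ne_zero, one_smul, zero_smul, add_zero]
  have hev : (fun x => fderiv ℂ f x v) =ᶠ[𝓝 x₀] fun x =>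
      (2 * Real.pi * Complex.I : ℂ)⁻¹ • ∮ ζ in C(0, ε), (1 / (ζ - 0) ^ 2) • f (x + ζ • v) := by
    filter_upwards [ball_mem_nhds x₀ hr] with x hx using hcauchy x hx
  refine DifferentiableAt.congr_of_eventuallyEq ?_ hev
  suffices hint : DifferentiableAt ℂ
      (fun x => ∮ ζ in C(0, ε), (1 / (ζ - 0) ^ 2) • f (x + ζ • v)) x₀ from hint.fun_const_smul _
  have hcm : ∀ θ, circleMap 0 ε θ ∈ closedBall (0 : ℂ) ε := fun θ =>
    circleMap_mem_closedBall 0 hε.le θ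
  have hcont : Continuous fun θ : ℝ =>
      deriv (circleMap 0 ε) θ * (1 / (circleMap 0 ε θ - 0) ^ 2) := by
    have h0 : ∀ θ, (circleMap 0 ε θ - 0) ^ 2 ≠ 0 := fun θ => by
      simpa using hε.ne'
    simp only [deriv_circleMap]
    exact ((continuous_circleMap 0 ε).mul continuous_const).mul
      (continuous_const.div (((continuous_circleMap 0 ε).sub continuous_const).pow 2) h0)
  have hFcont : ∀ x ∈ ball x₀ r, Continuous fun θ : ℝ =>
      (deriv (circleMap 0 ε) θ * (1 / (circleMap 0 ε θ - 0) ^ 2)) •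
        f (x + circleMap 0 ε θ • v) := by
    intro x hx
    refine hcont.smul (continuous_iff_continuousAt.2 fun θ => ?_)
    refine ContinuousAt.comp (f := fun θ : ℝ => x + circleMap 0 ε θ • v)
      (hdiff _ (hsub23 (hmem x hx _ (hcm θ)))).continuousAt ?_
    exact (continuous_const.add ((continuous_circleMap 0 ε).smul continuous_const)).continuousAt
  have key := intervalIntegral.hasFDerivAt_integral_of_dominated_of_fderiv_le (𝕜 := ℂ)
    (μ := MeasureTheory.volume) (a := 0) (b := 2 * Real.pi) (x₀ := x₀) (s := ball x₀ r)
    (bound := fun θ => ‖deriv (circleMap 0 ε) θ * (1 / (circleMap 0 ε θ - 0) ^ 2)‖ * ((M + M) / r))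
    (F := fun x θ => (deriv (circleMap 0 ε) θ * (1 / (circleMap 0 ε θ - 0) ^ 2)) •
        f (x + circleMap 0 ε θ • v))
    (F' := fun x θ => (deriv (circleMap 0 ε) θ * (1 / (circleMap 0 ε θ - 0) ^ 2)) •
        fderiv ℂ f (x + circleMap 0 ε θ • v))
    (ball_mem_nhds x₀ hr)
    (by filter_upwards [ball_mem_nhds x₀ hr] with x hx using
          (hFcont x hx).aestronglyMeasurable)
    ((hFcont x₀ (mem_ball_self hr)).intervalIntegrable _ _)
    (by
      -- Continuity of `fderiv ℂ f` is not known at this stage; measurability holds for any `f`.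
      refine hcont.aestronglyMeasurable.smul (Measurable.aestronglyMeasurable ?_)
      exact (measurable_fderiv ℂ f).comp (continuous_const.add
        ((continuous_circleMap 0 ε).smul continuous_const)).measurable)
    (by
      refine Eventually.of_forall fun θ _ x hx => ?_
      rw [norm_smul]
      exact mul_le_mul_of_nonneg_left (hbound _ (hmem x hx _ (hcm θ))) (norm_nonneg _))
    ((hcont.norm.mul continuous_const).intervalIntegrable _ _)
    (by
      refine Eventually.of_forall fun θ _ x hx => ?_
      have h1 : HasFDerivAt (fun x => f (x + circleMap 0 ε θ • v))
          (fderiv ℂ f (x + circleMap 0 ε θ • v)) x :=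
        (hdiff _ (hsub23 (hmem x hx _ (hcm θ)))).hasFDerivAt.comp x
          ((hasFDerivAt_id x).add_const _)
      exact h1.fun_const_smul _)
  refine key.differentiableAt.congr_of_eventuallyEq (Eventually.of_forall fun x => ?_)
  simp only [circleIntegral, smul_smul]

/-- The space of homogeneous polynomial functions of degree `m` on `ℂⁿ`. -/
def homogeneousSpan (n m : ℕ) : Submodule ℂ (CModel n → ℂ) :=
  Submodule.span ℂ ((fun (α : Fin n → ℕ) (z : CModel n) => ∏ i, z i ^ α i) '' {α | ∑ i, α i = m})

/-- The span of the monomials with all exponents less than `h`. -/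
def monomialSpan (n h : ℕ) : Submodule ℂ (CModel n → ℂ) :=
  Submodule.span ℂ (Set.range fun (α : Fin n → Fin h) (z : CModel n) => ∏ i, z i ^ (α i : ℕ))

instance (n h : ℕ) : Module.Finite ℂ (monomialSpan n h) :=
  Module.Finite.span_of_finite ℂ (Set.finite_range _)

/-- Bounding each exponent rather than the total degree makes the count immediate and costs only a
factor depending on `n`. -/
theorem finrank_monomialSpan_le (n h : ℕ) : Module.finrank ℂ (monomialSpan n h) ≤ h ^ n :=
  (finrank_range_le_card (R := ℂ)
    (fun (α : Fin n → Fin h) (z : CModel n) => ∏ i, z i ^ (α i : ℕ))).trans_eq (by simp)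

theorem homogeneousSpan_le_monomialSpan {n m h : ℕ} (hm : m < h) :
    homogeneousSpan n m ≤ monomialSpan n h := by
  refine Submodule.span_mono ?_
  rintro _ ⟨α, hα, rfl⟩
  have hlt : ∀ i, α i < h := fun i =>
    (Finset.single_le_sum (fun j _ => Nat.zero_le (α j)) (Finset.mem_univ i)).trans_lt
      (by rw [Set.mem_ofPred_eq] at hα; omega)
  exact ⟨fun i => ⟨α i, hlt i⟩, rfl⟩

/-- Used to separate the components of a jet: along `t • z` they become distinct powers of `t`. -/
theorem homogeneousSpan_apply_smul {n m : ℕ} {p : CModel n → ℂ} (hp : p ∈ homogeneousSpan n m)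
    (t : ℂ) (z : CModel n) : p (t • z) = t ^ m * p z := by
  induction hp using Submodule.span_induction with
  | mem p hp =>
    obtain ⟨α, hα, rfl⟩ := hp
    rw [Set.mem_ofPred_eq] at hα
    simp only [PiLp.smul_apply, smul_eq_mul, mul_pow, Finset.prod_mul_distrib]
    rw [Finset.prod_pow_eq_pow_sum, hα]
  | zero => simp
  | add p q _ _ hp hq => simp only [Pi.add_apply, hp, hq, mul_add]
  | smul c p _ hp => simp only [Pi.smul_apply, hp, smul_eq_mul]; ring

theorem coord_mul_mem_homogeneousSpan {n m : ℕ} {p : CModel n → ℂ}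
    (hp : p ∈ homogeneousSpan n m) (i : Fin n) :
    (fun z : CModel n => z i * p z) ∈ homogeneousSpan n (m + 1) := by
  induction hp using Submodule.span_induction with
  | mem p hp =>
    obtain ⟨α, hα, rfl⟩ := hp
    rw [Set.mem_ofPred_eq] at hα
    refine Submodule.subset_span ⟨α + Pi.single i 1, ?_, ?_⟩
    · simp [Finset.sum_add_distrib, hα]
    · ext z
      simp only [Pi.add_apply, pow_add, Finset.prod_mul_distrib]
      rw [mul_comm]
      congr 1
      rw [Finset.prod_eq_single i] <;> simp +contextual
  | zero =>
    simp only [Pi.zero_apply, mul_zero]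
    exact Submodule.zero_mem _
  | add p q _ _ hp hq =>
    simp only [Pi.add_apply, mul_add]
    exact Submodule.add_mem _ hp hq
  | smul c p _ hp =>
    simpa only [Pi.smul_def, smul_eq_mul, mul_left_comm] using Submodule.smul_mem _ c hp

theorem differentiableOn_comp_line {n : ℕ} {f : CModel n → ℂ} {U : Set (CModel n)}
    (hf : DifferentiableOn ℂ f U) (x z : CModel n) :
    DifferentiableOn ℂ (fun t : ℂ => f (x + t • z)) {t | x + t • z ∈ U} :=
  hf.comp (by fun_prop) fun _ ht => ht

theorem isOpen_preimage_line {n : ℕ} {U : Set (CModel n)} (hU : IsOpen U) (x z : CModel n) :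
    IsOpen {t : ℂ | x + t • z ∈ U} :=
  hU.preimage (by fun_prop)

theorem analyticAt_comp_line {n : ℕ} {f : CModel n → ℂ} {U : Set (CModel n)} (hU : IsOpen U)
    (hf : DifferentiableOn ℂ f U) {x : CModel n} (hx : x ∈ U) (z : CModel n) :
    AnalyticAt ℂ (fun t : ℂ => f (x + t • z)) 0 :=
  (differentiableOn_comp_line hf x z).analyticAt
    ((isOpen_preimage_line hU x z).mem_nhds (by simpa using hx))

/-- The Taylor coefficients along lines through `x` are homogeneous polynomials. -/
theorem iteratedDeriv_comp_line_mem {n : ℕ} {f : CModel n → ℂ} {U : Set (CModel n)}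
    (hU : IsOpen U) (hf : DifferentiableOn ℂ f U) {x : CModel n} (hx : x ∈ U) (m : ℕ) :
    (fun z : CModel n => iteratedDeriv m (fun t : ℂ => f (x + t • z)) 0) ∈
      homogeneousSpan n m := by
  -- By the chain rule, `d/dt f(x + t z) = ∑ zᵢ ∂ᵢf(x + t z)`. The induction hypothesis is applied
  -- to the partial derivatives, so `f` must vary.
  induction m generalizing f with
  | zero =>
    have h1 : (fun _ : CModel n => (1 : ℂ)) ∈ homogeneousSpan n 0 :=
      Submodule.subset_span ⟨0, by simp, by simp⟩
    have : (fun z : CModel n => iteratedDeriv 0 (fun t : ℂ => f (x + t • z)) 0) =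
        f x • fun _ : CModel n => (1 : ℂ) := by ext z; simp
    rw [this]
    exact Submodule.smul_mem _ _ h1
  | succ m ih =>
    have hd : ∀ i, DifferentiableOn ℂ
        (fun y => fderiv ℂ f y (EuclideanSpace.single i (1 : ℂ))) U :=
      fun i => differentiableOn_fderiv_apply hU hf _
    have : (fun z : CModel n => iteratedDeriv (m + 1) (fun t : ℂ => f (x + t • z)) 0) =
        ∑ i, fun z : CModel n => z i * iteratedDeriv m
          (fun t : ℂ => fderiv ℂ f (x + t • z) (EuclideanSpace.single i (1 : ℂ))) 0 := by
      ext z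
      have hev : deriv (fun t : ℂ => f (x + t • z)) =ᶠ[nhds 0] fun t => ∑ i, z i *
          fderiv ℂ f (x + t • z) (EuclideanSpace.single i (1 : ℂ)) := by
        filter_upwards [(isOpen_preimage_line hU x z).mem_nhds
          (show (0 : ℂ) ∈ _ by simpa using hx)] with t ht
        have h1 : HasDerivAt (fun t : ℂ => x + t • z) z t := by
          simpa using ((hasDerivAt_id t).smul_const z).const_add x
        have h2 : HasDerivAt (fun t : ℂ => f (x + t • z)) (fderiv ℂ f (x + t • z) z) t :=
          (hf.differentiableAt (hU.mem_nhds ht)).hasFDerivAt.comp_hasDerivAt t h1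
        rw [h2.deriv]
        have hz : z = ∑ i, z i • EuclideanSpace.single i (1 : ℂ) := by
          ext j; simp [Pi.single_apply]
        conv_lhs => rw [hz]
        simp only [map_sum, map_smul, smul_eq_mul]
        rw [← hz]
      rw [iteratedDeriv_succ', hev.iteratedDeriv_eq, Finset.sum_apply, iteratedDeriv_fun_sum]
      · refine Finset.sum_congr rfl fun i _ => ?_
        exact iteratedDeriv_const_mul_field (z i) _
      · intro i _
        exact contDiffAt_const.mul (analyticAt_comp_line hU (hd i) hx z).contDiffAt
    rw [this]
    exact Submodule.sum_mem _ fun i _ => coord_mul_mem_homogeneousSpan (ih (hd i)) i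

/-- The functions that are holomorphic on `U`. -/
def holomorphicSubmodule {n : ℕ} (U : Set (CModel n)) : Submodule ℂ (CModel n → ℂ) where
  carrier := {f | DifferentiableOn ℂ f U}
  add_mem' hf hg := DifferentiableOn.add hf hg
  zero_mem' := differentiableOn_const 0
  smul_mem' c _ hf := DifferentiableOn.const_smul hf c

/-- The Taylor polynomial of degree less than `h` at `x`, up to the normalization of its
homogeneous components. -/
noncomputable def jet {n : ℕ} {U : Set (CModel n)} (hU : IsOpen U) {x : CModel n} (hx : x ∈ U)
    (h : ℕ) : holomorphicSubmodule U →ₗ[ℂ] monomialSpan n h where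
  toFun f := ⟨∑ m ∈ Finset.range h, fun z => iteratedDeriv m (fun t : ℂ => f.1 (x + t • z)) 0,
    Submodule.sum_mem _ fun m hm => homogeneousSpan_le_monomialSpan (Finset.mem_range.1 hm)
      (iteratedDeriv_comp_line_mem hU f.2 hx m)⟩
  map_add' f g := by
    ext z
    simp only [Submodule.coe_add, Pi.add_apply, Finset.sum_apply, ← Finset.sum_add_distrib]
    refine Finset.sum_congr rfl fun m _ => ?_
    exact iteratedDeriv_fun_add (analyticAt_comp_line hU f.2 hx z).contDiffAt
      (analyticAt_comp_line hU g.2 hx z).contDiffAt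
  map_smul' c f := by
    ext z
    simp only [Submodule.coe_smul, Pi.smul_apply, Finset.sum_apply, smul_eq_mul, Finset.mul_sum,
      RingHom.id_apply]
    exact Finset.sum_congr rfl fun m _ => iteratedDeriv_const_mul_field c _

/-- At `t • z` the jet is a polynomial in `t` whose coefficients are the derivatives along the line;
it vanishes for all `t`, hence so do its coefficients. -/
theorem iteratedDeriv_eq_zero_of_jet_eq_zero {n : ℕ} {U : Set (CModel n)} (hU : IsOpen U)
    {x : CModel n} (hx : x ∈ U) {h : ℕ} {f : holomorphicSubmodule U} (hf : jet hU hx h f = 0)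
    {m : ℕ} (hm : m < h) (z : CModel n) :
    iteratedDeriv m (fun t : ℂ => f.1 (x + t • z)) 0 = 0 := by
  set a : ℕ → ℂ := fun m => iteratedDeriv m (fun t : ℂ => f.1 (x + t • z)) 0 with ha
  have hpoly : (∑ m ∈ Finset.range h, Polynomial.monomial m (a m) : Polynomial ℂ) = 0 := by
    refine Polynomial.funext fun t => ?_
    have h1 := congrFun (congrArg Subtype.val hf) (t • z)
    simp only [jet, LinearMap.coe_mk, AddHom.coe_mk, Finset.sum_apply, ZeroMemClass.coe_zero,
      Pi.zero_apply] at h1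
    rw [Polynomial.eval_finsetSum, Polynomial.eval_zero, ← h1]
    refine Finset.sum_congr rfl fun m _ => ?_
    rw [Polynomial.eval_monomial, mul_comm]
    exact (homogeneousSpan_apply_smul (iteratedDeriv_comp_line_mem hU f.2 hx m) t z).symm
  have h2 := congrArg (fun p => Polynomial.coeff p m) hpoly
  simpa [Polynomial.finsetSum_coeff, Polynomial.coeff_monomial, hm] using h2

open Metric Set Filter Topology Asymptotics in
/-- The Schwarz lemma for functions that vanish to high order at the centre of a ball. -/
theorem norm_le_of_jet_eq_zero {n : ℕ} {c : CModel n} {ρ : ℝ} (hρ : 0 < ρ) {h : ℕ}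
    {f : holomorphicSubmodule (ball c ρ)}
    (hf : jet isOpen_ball (mem_ball_self hρ) (h + 1) f = 0) {M : ℝ}
    (hM : ∀ z ∈ ball c ρ, ‖f.1 z‖ ≤ M) {z : CModel n} (hz : z ∈ ball c (ρ / 2)) :
    ‖f.1 z‖ ≤ M * (1 / 2) ^ (h + 1) := by
  -- Restriction to the line through `c` and `z`: since `z` lies in the half-size ball, `g` lives on
  -- the disc of radius 2 and `z` is `t = 1`, whence the ratio `1 / 2`.
  set g : ℂ → ℂ := fun t => f.1 (c + t • (z - c)) with hg
  have hder : ∀ i < h + 1, iteratedDeriv i g 0 = 0 := fun i hi =>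
    iteratedDeriv_eq_zero_of_jet_eq_zero isOpen_ball (mem_ball_self hρ) hf hi (z - c)
  have han : AnalyticAt ℂ g 0 :=
    analyticAt_comp_line isOpen_ball f.2 (mem_ball_self hρ) (z - c)
  have hg0 : g 0 = 0 := by simpa using hder 0 h.succ_pos
  have hmem : ∀ t ∈ ball (0 : ℂ) 2, c + t • (z - c) ∈ ball c ρ := by
    intro t ht
    rw [mem_ball, dist_eq_norm] at hz ht ⊢
    rw [sub_zero] at ht
    rw [add_sub_cancel_left, norm_smul]
    nlinarith [norm_nonneg t, norm_nonneg (z - c)]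
  have hlittle : (g · - g 0) =o[𝓝 0] fun t : ℂ => ‖t - 0‖ ^ h := by
    obtain ⟨G, hG, hgG⟩ := (natCast_le_analyticOrderAt han).1
      ((natCast_le_analyticOrderAt_iff_iteratedDeriv_eq_zero han).2 hder)
    have h1 : (fun t : ℂ => t ^ (h + 1) • G t) =o[𝓝 0] fun t : ℂ => ‖t - 0‖ ^ h := by
      have h2 : (fun t : ℂ => t * G t) =o[𝓝 0] fun _ : ℂ => (1 : ℝ) := by
        rw [isLittleO_one_iff]
        simpa [ContinuousAt] using! continuousAt_id.mul hG.continuousAt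
      have h3 : (fun t : ℂ => t ^ h) =O[𝓝 0] fun t : ℂ => ‖t - 0‖ ^ h :=
        IsBigO.of_bound 1 (Eventually.of_forall fun t => by simp)
      refine (h3.mul_isLittleO h2).congr (fun t => ?_) fun t => by simp
      rw [smul_eq_mul]; ring
    refine h1.congr' ?_ EventuallyEq.rfl
    filter_upwards [hgG] with t ht
    rw [hg0, sub_zero, ht, sub_zero]
  have key := Complex.dist_le_mul_div_pow_of_mapsTo_ball_of_isLittleO (z := 1) (R₂ := M)
    (show DifferentiableOn ℂ g (ball 0 2) from
      (differentiableOn_comp_line f.2 c (z - c)).mono hmem)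
    (fun t ht => by simpa [hg0] using hM _ (hmem t ht)) hlittle (by simp)
  rw [hg0, dist_zero_right] at key
  simpa [hg] using key

/-! ### The boundary estimate in `ℂⁿ`. -/

/-- A linear functional on a space `W` that is dominated by the norm of a linear map `r` from `W`
to a normed space factors through `r` by a functional of norm at most one. -/
theorem exists_strongDual_comp_eq {W B : Type*} [AddCommGroup W] [Module ℂ W]
    [NormedAddCommGroup B] [NormedSpace ℂ B] (r : W →ₗ[ℂ] B) (ev : W →ₗ[ℂ] ℂ)
    (h : ∀ w, ‖ev w‖ ≤ ‖r w‖) : ∃ L : StrongDual ℂ B, ‖L‖ ≤ 1 ∧ ∀ w, L (r w) = ev w := by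
  have hker : LinearMap.ker r ≤ LinearMap.ker ev := fun w hw => by
    rw [LinearMap.mem_ker] at hw ⊢
    simpa [hw] using h w
  set l : LinearMap.range r →ₗ[ℂ] ℂ :=
    ((LinearMap.ker r).liftQ ev hker).comp r.quotKerEquivRange.symm.toLinearMap with hl
  have hlr : ∀ w, l ⟨r w, LinearMap.mem_range_self r w⟩ = ev w := fun w => by
    have : r.quotKerEquivRange.symm ⟨r w, LinearMap.mem_range_self r w⟩ =
        (LinearMap.ker r).mkQ w := r.quotKerEquivRange_symm_apply_image w _
    rw [hl, LinearMap.comp_apply, LinearEquiv.coe_coe, this, Submodule.mkQ_apply,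
      Submodule.liftQ_apply]
  have hbound : ∀ y, ‖l y‖ ≤ 1 * ‖y‖ := by
    rintro ⟨_, w, rfl⟩
    rw [hlr, one_mul]
    exact h w
  obtain ⟨L, hL, hnorm⟩ := exists_extension_norm_eq (LinearMap.range r) (l.mkContinuous 1 hbound)
  refine ⟨L, hnorm ▸ LinearMap.mkContinuous_norm_le _ zero_le_one _, fun w => ?_⟩
  rw [← hlr w]
  exact hL ⟨r w, LinearMap.mem_range_self r w⟩

open Metric Set Filter Topology in
/-- A continuous curve in `C(Y, ℂ)` that is pointwise holomorphic is holomorphic. -/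
theorem differentiableOn_continuousMap {Y : Type*} [TopologicalSpace Y] [CompactSpace Y]
    {D : Set ℂ} (hD : IsOpen D) {u : ℂ → C(Y, ℂ)} (hu : ContinuousOn u D)
    (hd : ∀ y, DifferentiableOn ℂ (fun t => u t y) D) : DifferentiableOn ℂ u D := by
  intro t₀ ht₀
  apply DifferentiableAt.differentiableWithinAt
  obtain ⟨R, hR, hRD⟩ := nhds_basis_closedBall.mem_iff.1 (hD.mem_nhds ht₀)
  lift R to NNReal using hR.le
  have hsph : sphere t₀ (R : ℝ) ⊆ D := sphere_subset_closedBall.trans hRD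
  -- The `C(Y, ℂ)`-valued Cauchy integral is analytic. Evaluation at `y` commutes with it, so the
  -- scalar Cauchy formula identifies it with `u`.
  have hci : CircleIntegrable u t₀ R := (hu.mono hsph).circleIntegrable R.2
  have hps := hasFPowerSeriesOn_cauchy_integral hci (by exact_mod_cast hR)
  refine hps.analyticAt.differentiableAt.congr_of_eventuallyEq ?_
  filter_upwards [ball_mem_nhds t₀ hR] with w hw
  ext y
  rw [← ((hd y).mono hRD).diffContOnCl_ball subset_rfl
    |>.two_pi_i_inv_smul_circleIntegral_sub_inv_smul hw]
  rw [ContinuousMap.smul_apply]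
  congr 1
  have hne : ∀ z ∈ sphere t₀ (R : ℝ), z - w ≠ 0 := fun z hz h0 => by
    rw [sub_eq_zero.1 h0, mem_sphere] at hz
    rw [mem_ball] at hw
    exact hw.ne hz
  have hci' : CircleIntegrable (fun z => (z - w)⁻¹ • u z) t₀ R :=
    (((continuous_id.sub continuous_const).continuousOn.inv₀ hne).smul
      (hu.mono hsph)).circleIntegrable R.2
  have := ContinuousLinearMap.intervalIntegral_comp_comm (ContinuousMap.evalCLM ℂ y) hci'.out
  exact this

-- Currying turns joint continuity into continuity for the sup norm. The value 0 off `D` plays no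
-- role.
open Set Filter Topology in
theorem exists_differentiableOn_continuousMap {Y : Type*} [TopologicalSpace Y] [CompactSpace Y]
    {D : Set ℂ} (hD : IsOpen D) {v : ℂ → Y → ℂ}
    (hv : ContinuousOn (fun x : ℂ × Y => v x.1 x.2) (D ×ˢ univ))
    (hd : ∀ y, DifferentiableOn ℂ (fun t => v t y) D) :
    ∃ u : ℂ → C(Y, ℂ), DifferentiableOn ℂ u D ∧ ∀ t ∈ D, ∀ y, u t y = v t y := by
  classical
  have hc : Continuous fun x : D × Y => v x.1 x.2 :=
    hv.comp_continuous (f := fun x : D × Y => ((x.1 : ℂ), x.2)) (by fun_prop) fun x => ⟨x.1.2, mem_univ _⟩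
  set w : C(D, C(Y, ℂ)) := ContinuousMap.curry ⟨fun x : D × Y => v x.1 x.2, hc⟩ with hw
  set u : ℂ → C(Y, ℂ) := fun t => if h : t ∈ D then w ⟨t, h⟩ else 0 with hu
  have huv : ∀ t ∈ D, ∀ y, u t y = v t y := fun t ht y => by simp [hu, ht, hw]
  refine ⟨u, differentiableOn_continuousMap hD ?_ fun y => ?_, huv⟩
  · rw [continuousOn_iff_continuous_domRestrict]
    have : D.domRestrict u = w := by ext1 t; simp [hu]
    rw [this]
    exact w.continuous
  · exact (hd y).congr fun t ht => huv t ht y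

open Metric Set Filter Topology in
/-- Near a pseudoconcave boundary point, holomorphic functions on one side of the boundary are
bounded by their values on a compact set. -/
theorem exists_compact_bound_near {n : ℕ} {Ω : Set (CModel n)} (hΩ : IsOpen Ω)
    {q e : CModel n} {R : ℝ} (hR : 0 < R) (hq : q ∈ closure Ω)
    (hcone : ∀ z ∈ closure Ω, z ∈ ball q R → ∀ t : ℝ, 0 < t → z - (t : ℂ) • e ∈ ball q R →
      z - (t : ℂ) • e ∈ Ω)
    (hhull : ∀ N ∈ 𝓝 q, ∃ U ⊆ N, q ∈ interior {p | p ∈ U ∧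
      ∀ g : CModel n → ℂ, DifferentiableOn ℂ g U → ‖g p‖ₑ ≤ ⨆ z ∈ U ∩ Ω, ‖g z‖ₑ}) :
    ∃ V ∈ 𝓝 q, ∃ K ⊆ Ω ∩ ball q R, IsCompact K ∧ ∀ f : CModel n → ℂ,
      DifferentiableOn ℂ f (Ω ∩ ball q R) → ∀ M : ℝ, 0 ≤ M → (∀ y ∈ K, ‖f y‖ ≤ M) →
        ∀ x ∈ V ∩ Ω, ‖f x‖ ≤ M := by
  -- Plan: evaluation at a hull point `p` is a functional `L` of norm at most 1 on `C(K₀, ℂ)`.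
  -- Applied to `z ↦ f (z + (x - p) - t • e)` with `t` near `S`, it gives `f (x - t • e)`. Continued
  -- to `t = 0`, this expresses `f x` through values of `f` on a compact subset of `Ω`.
  obtain ⟨S, hS, hSe⟩ : ∃ S : ℝ, 0 < S ∧ S * ‖e‖ ≤ R / 4 := by
    refine ⟨R / 4 / (‖e‖ + 1), by positivity, ?_⟩
    rw [div_mul_eq_mul_div, div_le_iff₀ (by positivity)]
    nlinarith [norm_nonneg e]
  have hnorm : ∀ t : ℝ, 0 ≤ t → ‖(t : ℂ) • e‖ = t * ‖e‖ := fun t ht => by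
    rw [norm_smul, Complex.norm_of_nonneg ht]
  have hqS : q - (S : ℂ) • e ∈ Ω := hcone q hq (mem_ball_self hR) S hS (by
    rw [mem_ball, dist_eq_norm, sub_sub_cancel_left, norm_neg, hnorm S hS.le]; linarith)
  -- The radius `4 * η` accommodates `2 * η` for the ball carrying the translates, `η` for `x - q`,
  -- and `η / 2` each for `β • e` and `(t - S) • e`.
  obtain ⟨η, hη, hηR, hηΩ⟩ : ∃ η > 0, η ≤ R / 16 ∧ ball (q - (S : ℂ) • e) (4 * η) ⊆ Ω := by
    obtain ⟨r, hr, h⟩ := Metric.isOpen_iff.1 hΩ _ hqS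
    refine ⟨min (r / 4) (R / 16), by positivity, min_le_right _ _,
      (ball_subset_ball ?_).trans h⟩
    linarith [min_le_left (r / 4) (R / 16)]
  obtain ⟨U, hUη, hU⟩ := hhull _ (ball_mem_nhds q hη)
  -- As `q` is interior to the hull, it can be moved by `β • e` without leaving it. Translation by
  -- `x - p`, close to `-β • e`, then carries even the boundary points in `K₀` into `Ω`.
  obtain ⟨β, hβ, hβη, hβhull⟩ : ∃ β : ℝ, 0 < β ∧ β * ‖e‖ ≤ η / 2 ∧
      q + (β : ℂ) • e ∈ interior {p | p ∈ U ∧ ∀ g : CModel n → ℂ, DifferentiableOn ℂ g U →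
        ‖g p‖ₑ ≤ ⨆ z ∈ U ∩ Ω, ‖g z‖ₑ} := by
    have h1 : Tendsto (fun β : ℝ => q + (β : ℂ) • e) (𝓝 0) (𝓝 q) := by
      have : Continuous fun β : ℝ => q + (β : ℂ) • e := by fun_prop
      simpa using this.tendsto 0
    have h2 : Tendsto (fun β : ℝ => β * ‖e‖) (𝓝 0) (𝓝 0) := by
      have : Continuous fun β : ℝ => β * ‖e‖ := by fun_prop
      simpa using this.tendsto 0
    have h3 := (h1.eventually (isOpen_interior.mem_nhds hU)).and
      (h2.eventually (ge_mem_nhds (half_pos hη)))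
    obtain ⟨β, ⟨h4, h5⟩, h6⟩ := ((h3.filter_mono nhdsWithin_le_nhds).and
      (self_mem_nhdsWithin (s := Ioi (0 : ℝ)))).exists
    exact ⟨β, h6, h5, h4⟩
  set p := q + (β : ℂ) • e with hp
  obtain ⟨hpU, hphull⟩ := interior_subset hβhull
  set K₀ := closure (U ∩ Ω) with hK₀
  have hK₀η : K₀ ⊆ closedBall q η :=
    closure_minimal (inter_subset_left.trans (hUη.trans ball_subset_closedBall))
      isClosed_closedBall
  have hK₀Ω : K₀ ⊆ closure Ω := closure_mono inter_subset_right
  have hK₀c : IsCompact K₀ := (isCompact_closedBall q η).of_isClosed_subset isClosed_closure hK₀η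
  set O := Ω ∩ ball q R with hO
  have hOo : IsOpen O := hΩ.inter isOpen_ball
  -- All translates of `K₀` met during the continuation for `x = q`; a thickening will absorb `x -
  -- q`.
  set K₁ := (fun x : CModel n × ℝ => x.1 - ((β + x.2 : ℝ) : ℂ) • e) '' (K₀ ×ˢ Icc 0 S) with hK₁
  have hK₁c : IsCompact K₁ := (hK₀c.prod isCompact_Icc).image (by fun_prop)
  have hK₁O : K₁ ⊆ O := by
    rintro _ ⟨⟨z, t⟩, ⟨hz, ht⟩, rfl⟩
    have hz' := hK₀η hz
    simp only at hz hz' ht ⊢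
    rw [mem_closedBall] at hz'
    have hb : z - ((β + t : ℝ) : ℂ) • e ∈ ball q R := by
      rw [mem_ball, dist_eq_norm]
      rw [dist_eq_norm] at hz'
      calc ‖z - ((β + t : ℝ) : ℂ) • e - q‖ = ‖(z - q) - ((β + t : ℝ) : ℂ) • e‖ := by
            congr 1; abel
        _ ≤ ‖z - q‖ + (β + t) * ‖e‖ :=
            (norm_sub_le _ _).trans (by rw [hnorm _ (add_nonneg hβ.le ht.1)])
        _ < R := by nlinarith [norm_nonneg e, ht.2, ht.1]
    exact ⟨hcone z (hK₀Ω hz) (closedBall_subset_ball (by linarith) (hK₀η hz)) _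
      (add_pos_of_pos_of_nonneg hβ ht.1) hb, hb⟩
  obtain ⟨ρ, hρ, hρO⟩ := hK₁c.exists_cthickening_subset_open hOo hK₁O
  refine ⟨ball q (min ρ η), ball_mem_nhds _ (lt_min hρ hη), cthickening ρ K₁, hρO,
    hK₁c.cthickening, fun f hf M hM0 hM x hx => ?_⟩
  have hxρ : ‖x - q‖ < ρ := by
    rw [← dist_eq_norm]; exact (mem_ball.1 hx.1).trans_le (min_le_left _ _)
  have hxη : ‖x - q‖ < η := by
    rw [← dist_eq_norm]; exact (mem_ball.1 hx.1).trans_le (min_le_right _ _)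
  have hshift : ∀ z ∈ K₀, ∀ t ∈ Icc 0 S, z + (x - p) - (t : ℂ) • e ∈ cthickening ρ K₁ := by
    intro z hz t ht
    refine mem_cthickening_of_dist_le _ (z - ((β + t : ℝ) : ℂ) • e) ρ K₁
      ⟨(z, t), ⟨hz, ht⟩, rfl⟩ ?_
    rw [dist_eq_norm]
    have : z + (x - p) - (t : ℂ) • e - (z - ((β + t : ℝ) : ℂ) • e) = x - q := by
      rw [hp]; push_cast; module
    rw [this]
    exact hxρ.le
  have hline : ∀ t ∈ Icc 0 S, x - (t : ℂ) • e ∈ O := by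
    intro t ht
    have hb : x - (t : ℂ) • e ∈ ball q R := by
      rw [mem_ball, dist_eq_norm]
      calc ‖x - (t : ℂ) • e - q‖ = ‖(x - q) - (t : ℂ) • e‖ := by congr 1; abel
        _ ≤ ‖x - q‖ + t * ‖e‖ := (norm_sub_le _ _).trans (by rw [hnorm _ ht.1])
        _ < R := by nlinarith [norm_nonneg e, ht.2]
    refine ⟨?_, hb⟩
    rcases ht.1.eq_or_lt with h0 | h0
    · rw [← h0]; simpa using hx.2
    · refine hcone x (subset_closure hx.2) ?_ t h0 hb
      rw [mem_ball, dist_eq_norm]; linarith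
  -- The parameters for which the translates used below stay in the domain of `f`.
  set D : Set ℂ := {t | (∀ z ∈ K₀, z + (x - p) - t • e ∈ O) ∧ x - t • e ∈ O} with hD
  have hDo : IsOpen D := by
    rw [isOpen_iff_eventually]
    rintro t ⟨ht1, ht2⟩
    refine Eventually.and (hK₀c.eventually_forall_of_forall_eventually fun z hz => ?_) ?_
    · have : Continuous fun y : ℂ × CModel n => y.2 + (x - p) - y.1 • e := by fun_prop
      exact this.continuousAt.eventually (hOo.mem_nhds (ht1 z hz))
    · have : Continuous fun s : ℂ => x - s • e := by fun_prop
      exact this.continuousAt.eventually (hOo.mem_nhds ht2)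
  have hsegD : (fun t : ℝ => (t : ℂ)) '' Icc 0 S ⊆ D := by
    rintro _ ⟨t, ht, rfl⟩
    exact ⟨fun z hz => hρO (hshift z hz t ht), hline t ht⟩
  have : CompactSpace K₀ := isCompact_iff_compactSpace.1 hK₀c
  obtain ⟨u, hu, huv⟩ := exists_differentiableOn_continuousMap (Y := K₀) hDo
    (v := fun t z => f (z + (x - p) - t • e))
    (hf.continuousOn.comp (by fun_prop) fun y hy => hy.1.1 y.2 y.2.2)
    (fun z => hf.comp (by fun_prop) fun t ht => ht.1 z z.2)
  have hK₀2 : ∀ z ∈ K₀, z ∈ ball q (2 * η) := fun z hz =>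
    closedBall_subset_ball (by linarith) (hK₀η hz)
  -- The hull inequality at `p` bounds evaluation there by the sup norm on `K₀`, which contains `U ∩
  -- Ω`.
  obtain ⟨L, hL1, hL⟩ := exists_strongDual_comp_eq
    (W := holomorphicSubmodule (ball q (2 * η))) (B := C(K₀, ℂ))
    { toFun := fun g => ⟨fun z => g.1 z,
        (DifferentiableOn.continuousOn g.2).comp_continuous continuous_subtype_val
          fun z => hK₀2 z z.2⟩
      map_add' := fun g h => rfl
      map_smul' := fun c g => rfl }
    { toFun := fun g => g.1 p
      map_add' := fun g h => rfl
      map_smul' := fun c g => rfl }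
    (fun g => by
      have hgU : DifferentiableOn ℂ g.1 U := DifferentiableOn.mono g.2
        (hUη.trans (ball_subset_ball (by linarith)))
      rw [← enorm_le_iff_norm_le]
      refine (hphull g.1 hgU).trans (iSup₂_le fun z hz => ?_)
      rw [enorm_le_iff_norm_le]
      exact ContinuousMap.norm_coe_le_norm (⟨fun z => g.1 z, _⟩ : C(K₀, ℂ))
        ⟨z, subset_closure hz⟩)
  have hF : DifferentiableOn ℂ (fun t => L (u t)) D := L.differentiable.comp_differentiableOn hu
  have hG : DifferentiableOn ℂ (fun t : ℂ => f (x - t • e)) D :=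
    hf.comp (by fun_prop) fun t ht => ht.2
  have hSmem : (S : ℂ) ∈ (fun t : ℝ => (t : ℂ)) '' Icc 0 S := ⟨S, ⟨hS.le, le_rfl⟩, rfl⟩
  have hev : (fun t => L (u t)) =ᶠ[𝓝 (S : ℂ)] fun t : ℂ => f (x - t • e) := by
    have hclose : ∀ᶠ t : ℂ in 𝓝 (S : ℂ), ‖(t - S) • e‖ < η / 2 := by
      have : Continuous fun t : ℂ => ‖(t - S) • e‖ := by fun_prop
      exact this.continuousAt.eventually (gt_mem_nhds (by simpa using hη))
    filter_upwards [hclose, hDo.mem_nhds (hsegD hSmem)] with t ht htD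
    have hmaps : MapsTo (fun y => y + (x - p) - t • e) (ball q (2 * η)) O := by
      intro y hy
      rw [mem_ball, dist_eq_norm] at hy
      have hlt : ‖y + (x - p) - t • e - (q - (S : ℂ) • e)‖ < 4 * η := by
        calc ‖y + (x - p) - t • e - (q - (S : ℂ) • e)‖
            = ‖(y - q) + (x - q) - (β : ℂ) • e - (t - S) • e‖ := by
              congr 1; rw [hp]; module
          _ ≤ ‖y - q‖ + ‖x - q‖ + β * ‖e‖ + ‖(t - S) • e‖ := by
              refine (norm_sub_le _ _).trans (add_le_add_left ?_ _)
              refine (norm_sub_le _ _).trans ?_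
              rw [hnorm β hβ.le]
              exact add_le_add_left (norm_add_le _ _) _
          _ < 4 * η := by linarith
      have hdist : dist (q - (S : ℂ) • e) q ≤ R / 4 := by
        rw [dist_eq_norm, sub_sub_cancel_left, norm_neg, hnorm S hS.le]; exact hSe
      have hmem : y + (x - p) - t • e ∈ ball (q - (S : ℂ) • e) (4 * η) := by
        rwa [mem_ball, dist_eq_norm]
      exact ⟨hηΩ hmem, ball_subset_ball' (by linarith) hmem⟩
    have hg : DifferentiableOn ℂ (fun y => f (y + (x - p) - t • e)) (ball q (2 * η)) :=
      hf.comp (by fun_prop) hmaps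
    have h1 := hL ⟨_, hg⟩
    have h2 : p + (x - p) - t • e = x - t • e := by abel
    simp only [LinearMap.coe_mk, AddHom.coe_mk, h2] at h1
    rw [← h1]
    congr 1
    ext z
    exact huv t htD z
  have hEq := (hF.analyticOnNhd hDo |>.mono hsegD).eqOn_of_preconnected_of_eventuallyEq
    (hG.analyticOnNhd hDo |>.mono hsegD)
    (isPreconnected_Icc.image _ Complex.continuous_ofReal.continuousOn) hSmem hev
    ⟨0, ⟨le_rfl, hS.le⟩, rfl⟩
  simp only [Complex.ofReal_zero, zero_smul, sub_zero] at hEq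
  rw [← hEq]
  refine (L.le_of_opNorm_le hL1 _).trans ?_
  rw [one_mul, ContinuousMap.norm_le _ hM0]
  intro z
  rw [huv 0 (hsegD ⟨0, ⟨le_rfl, hS.le⟩, by simp⟩)]
  refine hM _ ?_
  simpa using hshift z z.2 0 ⟨le_rfl, hS.le⟩

/-! ### Smooth boundaries and transfer to the manifold. -/

open Metric Set Filter Topology in
/-- The sublevel set of a function with nonzero strict derivative at a boundary point is, near this
point, mapped into itself by translation in a suitable direction. -/
theorem exists_direction_of_strictDeriv {n : ℕ} {ρ : CModel n → ℝ} {q : CModel n}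
    {ρ' : CModel n →L[ℝ] ℝ} (hρ : HasStrictFDerivAt ρ ρ' q) (hρ' : ρ' ≠ 0) :
    ∃ e : CModel n, ∃ R > 0, ∀ z ∈ ball q R, ∀ t : ℝ, 0 < t → z - (t : ℂ) • e ∈ ball q R →
      ρ (z - (t : ℂ) • e) < ρ z := by
  obtain ⟨e, he⟩ : ∃ e, 0 < ρ' e := by
    obtain ⟨v, hv⟩ := DFunLike.ne_iff.1 hρ'
    rcases lt_or_gt_of_ne hv with h | h
    · exact ⟨-v, by simpa using h⟩
    · exact ⟨v, by simpa using h⟩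
  -- Strict differentiability compares any two points near `q`; with this constant the error for the
  -- step `t • e` is less than the main term `t * ρ' e`.
  have hc : 0 < ρ' e / (‖e‖ + 1) := by positivity
  have hev := hρ.isLittleO.def hc
  rw [nhds_prod_eq] at hev
  obtain ⟨R, hR, h⟩ := (nhds_basis_ball.prod_self.eventually_iff).1 hev
  refine ⟨e, R, hR, fun z hz t ht hzt => ?_⟩
  have h1 := h (mk_mem_prod hz hzt)
  have h2 : z - (z - (t : ℂ) • e) = t • e := by
    rw [sub_sub_cancel]; ext i; simp
  have h3 : ‖t • e‖ = t * ‖e‖ := by rw [norm_smul, Real.norm_of_nonneg ht.le]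
  rw [h2, map_smul, h3, smul_eq_mul, Real.norm_eq_abs] at h1
  have h4 : ρ' e / (‖e‖ + 1) * (t * ‖e‖) < t * ρ' e := by
    rw [div_mul_eq_mul_div, div_lt_iff₀ (by positivity)]
    nlinarith [mul_pos ht he]
  linarith [(abs_le.1 h1).1]

section Manifold

variable {n : ℕ} {X : Type*} [TopologicalSpace X] [ChartedSpace (CModel n) X]

theorem HolomorphicOn.differentiableOn_comp_chartAt_symm [IsManifold 𝓘(ℂ, CModel n) ω X]
    {f : X → ℂ} {W : Set X} (hf : HolomorphicOn n f W) (x : X) :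
    DifferentiableOn ℂ (f ∘ (chartAt (CModel n) x).symm)
      ((chartAt (CModel n) x).target ∩ (chartAt (CModel n) x).symm ⁻¹' W) := by
  have : IsManifold 𝓘(ℂ, CModel n) 1 X := IsManifold.of_le (n := ω) le_top
  rw [← mdifferentiableOn_iff_differentiableOn]
  exact MDifferentiableOn.comp hf
    ((mdifferentiableOn_atlas_symm (chart_mem_atlas _ x)).mono Set.inter_subset_left)
    fun y hy => hy.2

theorem holomorphicOn_comp_chartAt [IsManifold 𝓘(ℂ, CModel n) ω X] {g : CModel n → ℂ} {x : X}
    {U : Set X} (hU : U ⊆ (chartAt (CModel n) x).source)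
    (hg : DifferentiableOn ℂ g (chartAt (CModel n) x '' U)) :
    HolomorphicOn n (g ∘ chartAt (CModel n) x) U := by
  have : IsManifold 𝓘(ℂ, CModel n) 1 X := IsManifold.of_le (n := ω) le_top
  exact MDifferentiableOn.comp (mdifferentiableOn_iff_differentiableOn.2 hg)
    ((mdifferentiableOn_atlas (chart_mem_atlas _ x)).mono hU) fun y hy => Set.mem_image_of_mem _ hy

open Metric Set Filter Topology in
/-- A domain with smooth boundary is, in a chart at a boundary point, mapped into itself by
translation in a suitable direction. -/
theorem HasSmoothBoundary.exists_direction {Ω : Set X} (hΩ : HasSmoothBoundary n Ω) {q : X}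
    (hq : q ∈ frontier Ω) :
    ∃ e : CModel n, ∃ R₀ > 0, ∀ R ≤ R₀,
      ∀ z ∈ closure ((chartAt (CModel n) q).target ∩ (chartAt (CModel n) q).symm ⁻¹' Ω),
      z ∈ ball (chartAt (CModel n) q q) R → ∀ t : ℝ, 0 < t →
        z - (t : ℂ) • e ∈ ball (chartAt (CModel n) q q) R →
          z - (t : ℂ) • e ∈
            (chartAt (CModel n) q).target ∩ (chartAt (CModel n) q).symm ⁻¹' Ω := by
  obtain ⟨U, r, hUo, hqU, hr, hr', hrΩ⟩ := hΩ q hq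
  set φ := chartAt (CModel n) q with hφ
  have hqs : q ∈ φ.source := mem_chart_source _ q
  have hrq := (hr q hqU).contMDiffAt (hUo.mem_nhds hqU)
  have hcd : ContDiffAt ℝ ∞ (r ∘ φ.symm) (φ q) := by
    have h1 := (contMDiffAt_iff.1 hrq).2
    rw [ModelWithCorners.range_eq_univ] at h1
    exact h1
  have hfd : fderiv ℝ (r ∘ φ.symm) (φ q) ≠ 0 := by
    have h1 := hr' q hqU
    rw [(hrq.mdifferentiableAt (by simp)).mfderiv] at h1
    rwa [ModelWithCorners.range_eq_univ, fderivWithin_univ] at h1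
  obtain ⟨e, R₁, hR₁, h⟩ := exists_direction_of_strictDeriv
    (hcd.hasStrictFDerivAt (by simp)) hfd
  obtain ⟨R₂, hR₂, hsub⟩ := Metric.isOpen_iff.1 (φ.isOpen_inter_preimage_symm hUo) (φ q)
    ⟨φ.map_source hqs, by simpa [hqs] using hqU⟩
  refine ⟨e, min R₁ R₂, lt_min hR₁ hR₂, fun R hR z hz hzR t ht hzt => ?_⟩
  have hb₁ := ball_subset_ball (x := φ q) (hR.trans (min_le_left _ _))
  have hb₂ := (ball_subset_ball (x := φ q) (hR.trans (min_le_right _ _))).trans hsub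
  have hcont : ContinuousOn (r ∘ φ.symm) (ball (φ q) R) :=
    hr.continuousOn.comp (φ.continuousOn_symm.mono fun y hy => (hb₂ hy).1) fun y hy => (hb₂ hy).2
  -- On the closure only `r ≤ 0` is available; the strict decrease along `-e` gives `r < 0`.
  have hle : (r ∘ φ.symm) z ≤ 0 := by
    by_contra! hlt
    have h1 := (hcont.continuousAt (isOpen_ball.mem_nhds hzR)).eventually (lt_mem_nhds hlt)
    obtain ⟨y, ⟨hy1, hy2⟩, hy3⟩ := mem_closure_iff_nhds.1 hz _
      (inter_mem h1 (isOpen_ball.mem_nhds hzR))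
    exact lt_asymm hy1 ((hrΩ _ (hb₂ hy2).2).1 hy3.2)
  exact ⟨(hb₂ hzt).1, (hrΩ _ (hb₂ hzt).2).2 ((h z (hb₁ hzR) t ht (hb₁ hzt)).trans_le hle)⟩

open Metric Set Filter Topology in
/-- Near a pseudoconcave boundary point, holomorphic functions on the domain are bounded by their
values on a compact subset of the domain. -/
theorem exists_isCompact_bound_of_isPseudoconcavePoint [T2Space X]
    [IsManifold 𝓘(ℂ, CModel n) ω X] {Ω : Set X} (hΩ : IsOpen Ω)
    (hΩs : HasSmoothBoundary n Ω) {q : X} (hq : q ∈ frontier Ω)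
    (hqc : IsPseudoconcavePoint n Ω q) {W : Set X} (hW : IsOpen W) (hqW : q ∈ W) :
    ∃ V ∈ 𝓝 q, IsCompact V ∧ V ⊆ W ∧ ∃ K ⊆ Ω ∩ W, IsCompact K ∧ ∀ f : X → ℂ,
      HolomorphicOn n f (Ω ∩ W) → ∀ M : ℝ, 0 ≤ M → (∀ y ∈ K, ‖f y‖ ≤ M) →
        ∀ x ∈ V ∩ Ω, ‖f x‖ ≤ M := by
  obtain ⟨e, R₀, hR₀, hdir⟩ := hΩs.exists_direction hq
  set φ := chartAt (CModel n) q with hφ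
  have hqs : q ∈ φ.source := mem_chart_source _ q
  obtain ⟨R₁, hR₁, hsub⟩ := Metric.isOpen_iff.1 (φ.isOpen_inter_preimage_symm hW) (φ q)
    ⟨φ.map_source hqs, by simpa [hqs] using hqW⟩
  set R := min R₀ R₁ with hR
  set Ω' := φ.target ∩ φ.symm ⁻¹' Ω with hΩ'
  have hRW : ball (φ q) R ⊆ φ.target ∩ φ.symm ⁻¹' W :=
    (ball_subset_ball (min_le_right _ _)).trans hsub
  have hqΩ' : φ q ∈ closure Ω' := by
    rw [mem_closure_iff_nhds]
    intro N hN
    have h1 : φ ⁻¹' N ∩ φ.source ∈ 𝓝 q :=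
      inter_mem (φ.continuousAt hqs hN) (φ.open_source.mem_nhds hqs)
    obtain ⟨y, ⟨hy1, hy2⟩, hy3⟩ := mem_closure_iff_nhds.1 (frontier_subset_closure hq) _ h1
    exact ⟨φ y, hy1, φ.map_source hy2, by simpa [hy2] using hy3⟩
  obtain ⟨V, hV, K, hK, hKc, hbound⟩ := exists_compact_bound_near (R := R)
    (φ.isOpen_inter_preimage_symm hΩ) (lt_min hR₀ hR₁) hqΩ'
    (hdir R (min_le_left _ _)) (fun N hN => by
      obtain ⟨𝒰, h𝒰, hbasis, hhull⟩ := hqc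
      obtain ⟨U, hU, hUN⟩ := hbasis _
        (inter_mem (φ.continuousAt hqs hN) (φ.open_source.mem_nhds hqs))
      -- The hull condition passes to the chart because holomorphic functions on `φ '' U` pull back
      -- to `U`.
      refine ⟨φ '' U, ?_, ?_⟩
      · rintro _ ⟨y, hy, rfl⟩
        exact (hUN hy).1
      have hUs : U ⊆ φ.source := fun y hy => (hUN hy).2
      have hint : interior (holHull n U Ω) ⊆ U := interior_subset.trans fun y hy => hy.1
      refine mem_interior.2 ⟨φ '' interior (holHull n U Ω), ?_,
        φ.isOpen_image_of_subset_source isOpen_interior (hint.trans hUs),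
        mem_image_of_mem _ (hhull U hU)⟩
      rintro _ ⟨p, hp, rfl⟩
      refine ⟨mem_image_of_mem _ (hint hp), fun g hg => ?_⟩
      refine ((interior_subset hp).2 _ (holomorphicOn_comp_chartAt hUs hg)).trans
        (iSup₂_le fun z hz => ?_)
      exact le_iSup₂_of_le (f := fun y (_ : y ∈ φ '' U ∩ Ω') => ‖g y‖ₑ) (φ z)
        ⟨mem_image_of_mem _ hz.1, φ.map_source (hUs hz.1), by simpa [hUs hz.1] using hz.2⟩ le_rfl)
  have : LocallyCompactSpace X := ChartedSpace.locallyCompactSpace (CModel n) X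
  have hVX : φ ⁻¹' V ∩ φ.source ∩ W ∈ 𝓝 q := inter_mem
    (inter_mem (φ.continuousAt hqs hV) (φ.open_source.mem_nhds hqs)) (hW.mem_nhds hqW)
  obtain ⟨V', hV', hV'sub, hV'c⟩ := local_compact_nhds hVX
  refine ⟨V', hV', hV'c, fun y hy => (hV'sub hy).2, φ.symm '' K, ?_,
    hKc.image_of_continuousOn (φ.continuousOn_symm.mono fun y hy => (hK hy).1.1), ?_⟩
  · rintro _ ⟨y, hy, rfl⟩
    exact ⟨(hK hy).1.2, (hRW (hK hy).2).2⟩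
  · intro f hf M hM0 hM x hx
    have hxs := (hV'sub hx.1).1
    have h1 := hbound (f ∘ φ.symm) ((hf.differentiableOn_comp_chartAt_symm q).mono
      fun y hy => ⟨hy.1.1, hy.1.2, (hRW hy.2).2⟩) M hM0
      (fun y hy => hM _ (mem_image_of_mem _ hy)) (φ x)
      ⟨hxs.1, φ.map_source hxs.2, by simpa [hxs.2] using hx.2⟩
    simpa [hxs.2] using h1

end Manifold

/-! ### Uniform constants for changes of frame. -/

theorem Finset.exists_one_le_of_forall {α : Type*} (A : Finset α) {P : α → ℝ → Prop}
    (hmono : ∀ a C C', C ≤ C' → P a C → P a C') (h : ∀ a ∈ A, ∃ C, 1 ≤ C ∧ P a C) :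
    ∃ C, 1 ≤ C ∧ ∀ a ∈ A, P a C := by
  classical
  induction A using Finset.induction_on with
  | empty => exact ⟨1, le_rfl, by simp⟩
  | insert a A _ ih =>
    obtain ⟨C₁, hC₁, h₁⟩ := ih fun b hb => h b (Finset.mem_insert_of_mem hb)
    obtain ⟨C₂, hC₂, h₂⟩ := h a (Finset.mem_insert_self a A)
    refine ⟨max C₁ C₂, le_max_of_le_left hC₁, fun b hb => ?_⟩
    rcases Finset.mem_insert.1 hb with rfl | hb
    · exact hmono _ _ _ (le_max_right _ _) h₂
    · exact hmono _ _ _ (le_max_left _ _) (h₁ b hb)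

namespace ClosureLineBundle

variable {n : ℕ} {X : Type*} [TopologicalSpace X] [ChartedSpace (CModel n) X]
  {Ω : Set X} {ι : Type*}

/-- Changing frames over a compact set costs at most a constant to the power `k`. -/
theorem exists_norm_le_of_isCompact (E : ClosureLineBundle n Ω ι) {P : Set X} (hP : IsCompact P)
    {i j : ι} (hPs : P ⊆ Ω ∩ (E.cover i ∩ E.cover j)) :
    ∃ C : ℝ, 1 ≤ C ∧ ∀ k, ∀ s ∈ (E.tensorPow k).sections, ∀ y ∈ P,
      ‖s j y‖ ≤ C ^ k * ‖s i y‖ := by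
  obtain ⟨C, hC⟩ := hP.exists_bound_of_continuousOn
    ((E.holomorphic_g i j).continuousOn.mono hPs)
  refine ⟨max 1 C, le_max_left _ _, fun k s hs y hy => ?_⟩
  rw [hs.2.1 i j y (hPs hy), norm_mul, mul_comm]
  refine mul_le_mul_of_nonneg_right ?_ (norm_nonneg _)
  change ‖E.g i j y ^ k‖ ≤ _
  rw [norm_pow]
  exact pow_le_pow_left₀ (norm_nonneg _) ((hC y hy).trans (le_max_right _ _)) k

/-- Bounds for a section on finitely many sets, in fixed frames, give bounds in another frame. -/
theorem exists_norm_le_of_cover [T2Space X] (E : ClosureLineBundle n Ω ι) {α : Type*}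
    (A : Finset α) {i : α → ι} {B B' : α → Set X} (hB'c : ∀ a, IsCompact (B' a))
    (hB' : ∀ a, B' a ⊆ Ω ∩ E.cover (i a)) (hBB' : ∀ a, B a ⊆ B' a) {Q : Set X}
    (hQc : IsCompact Q) {j : ι} (hQ : Q ⊆ Ω ∩ E.cover j) :
    ∃ C : ℝ, 1 ≤ C ∧ ∀ k, ∀ s ∈ (E.tensorPow k).sections, ∀ M : ℝ, 0 ≤ M →
      (∀ a ∈ A, ∀ y ∈ B a, ‖s (i a) y‖ ≤ M) →
        ∀ y ∈ Q, (∃ a ∈ A, y ∈ B a) → ‖s j y‖ ≤ C ^ k * M := by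
  obtain ⟨C, hC1, hC⟩ := A.exists_one_le_of_forall
    -- Writing `max 1 C` makes the property monotone in every real `C`, negative ones included.
    (P := fun a C => ∀ k, ∀ s ∈ (E.tensorPow k).sections, ∀ y ∈ B' a ∩ Q,
      ‖s j y‖ ≤ max 1 C ^ k * ‖s (i a) y‖)
    (fun a C C' hCC' h k s hs y hy => (h k s hs y hy).trans
      (mul_le_mul_of_nonneg_right (pow_le_pow_left₀ (by positivity)
        (max_le_max_left 1 hCC') k) (norm_nonneg _)))
    (fun a _ => by
      obtain ⟨C, hC1, hC⟩ := E.exists_norm_le_of_isCompact ((hB'c a).inter hQc)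
        (i := i a) (j := j) fun y hy => ⟨(hB' a hy.1).1, (hB' a hy.1).2, (hQ hy.2).2⟩
      exact ⟨C, hC1, by rwa [max_eq_right hC1]⟩)
  refine ⟨C, hC1, fun k s hs M hM h y hy ⟨a, ha, hya⟩ => ?_⟩
  rw [max_eq_right hC1] at hC
  exact (hC a ha k s hs y ⟨hBB' a hya, hy⟩).trans
    (mul_le_mul_of_nonneg_left (h a ha y hya) (by positivity))

end ClosureLineBundle

/-! ### Siegel's argument and the dimension count. -/

open Metric Set Filter Topology in
/-- The space of sections of `E ^ k` over a relatively compact pseudoconcave open set has dimension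
at most `C * k ^ n`. Boundary points are handled by `exists_isCompact_bound_of_isPseudoconcavePoint`;
then the Schwarz lemma shows that a section whose jets of order proportional to `k` vanish at
finitely many points is zero. -/
theorem ClosureLineBundle.exists_finrank_sections_le {n : ℕ} {X : Type*} [TopologicalSpace X] [T2Space X]
    [ChartedSpace (CModel n) X] [IsManifold 𝓘(ℂ, CModel n) ω X]
    {Ω : Set X} (hΩ_open : IsOpen Ω)
    (hΩ_compact : IsCompact (closure Ω)) (hΩ_smooth : HasSmoothBoundary n Ω)
    (hΩ_concave : IsAndreottiPseudoconcave n Ω)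
    {ι : Type*} (E : ClosureLineBundle n Ω ι) :
    ∃ C : ℝ, ∀ k : ℕ, 1 ≤ k →
      Module.Finite ℂ (E.tensorPow k).sections ∧
        (Module.finrank ℂ (E.tensorPow k).sections : ℝ) ≤ C * (k : ℝ) ^ n := by
  have hcover : ∀ x ∈ closure Ω, ∃ i, x ∈ E.cover i := fun x hx =>
    mem_iUnion.1 (E.closure_subset hx)
  have hbd : ∀ q : frontier Ω, ∃ (i : ι) (V : Set X), V ∈ 𝓝 (q : X) ∧ IsCompact V ∧
      V ⊆ E.cover i ∧ ∃ K ⊆ Ω ∩ E.cover i, IsCompact K ∧ ∀ f : X → ℂ,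
        HolomorphicOn n f (Ω ∩ E.cover i) → ∀ M : ℝ, 0 ≤ M → (∀ y ∈ K, ‖f y‖ ≤ M) →
          ∀ x ∈ V ∩ Ω, ‖f x‖ ≤ M := by
    rintro ⟨q, hq⟩
    obtain ⟨i, hi⟩ := hcover q (frontier_subset_closure hq)
    exact ⟨i, exists_isCompact_bound_of_isPseudoconcavePoint hΩ_open hΩ_smooth hq
      (hΩ_concave q hq) (E.isOpen_cover i) hi⟩
  choose ib V hV hVc hVi Kb hKbi hKbc hbound using hbd
  obtain ⟨T, hT⟩ := (hΩ_compact.of_isClosed_subset isClosed_frontier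
    frontier_subset_closure).elim_nhds_subcover' (fun q hq => interior (V ⟨q, hq⟩))
    fun q hq => interior_mem_nhds.2 (hV ⟨q, hq⟩)
  -- What the boundary neighbourhoods leave over is compact in `Ω`; `K` adds the compact sets that
  -- control these neighbourhoods.
  set L := closure Ω \ ⋃ q ∈ T, interior (V q) with hL
  have hLc : IsCompact L := hΩ_compact.diff (isOpen_biUnion fun _ _ => isOpen_interior)
  set K := L ∪ ⋃ q ∈ T, Kb q with hK
  have hKc : IsCompact K := hLc.union (T.isCompact_biUnion fun q _ => hKbc q)
  have hKΩ : K ⊆ Ω := by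
    refine union_subset (fun x hx => ?_) (iUnion₂_subset fun q _ => (hKbi q).trans inter_subset_left)
    by_contra hxΩ
    exact hx.2 (hT (by rw [hΩ_open.frontier_eq]; exact ⟨hx.1, hxΩ⟩))
  have hball : ∀ x : K, ∃ (i : ι) (ρ : ℝ), 0 < ρ ∧
      closedBall (chartAt (CModel n) (x : X) x) ρ ⊆ (chartAt (CModel n) (x : X)).target ∩
        (chartAt (CModel n) (x : X)).symm ⁻¹' (Ω ∩ E.cover i) := by
    rintro ⟨x, hx⟩
    obtain ⟨i, hi⟩ := hcover x (subset_closure (hKΩ hx))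
    obtain ⟨ρ, hρ, hsub⟩ := nhds_basis_closedBall.mem_iff.1
      (((chartAt (CModel n) x).isOpen_inter_preimage_symm
        (hΩ_open.inter (E.isOpen_cover i))).mem_nhds
        ⟨mem_chart_target _ x, by simpa using ⟨hKΩ hx, hi⟩⟩)
    exact ⟨i, ρ, hρ, hsub⟩
  choose i ρ hρ hρsub using hball
  -- The Schwarz lemma passes from `B'` to the half-size `B`; finitely many `B` will cover `K`, and
  -- each compact `B'` lies in one frame.
  set B : K → Set X := fun x => (chartAt (CModel n) (x : X)).source ∩
    chartAt (CModel n) (x : X) ⁻¹' ball (chartAt (CModel n) (x : X) x) (ρ x / 2) with hB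
  set B' : K → Set X := fun x =>
    (chartAt (CModel n) (x : X)).symm '' closedBall (chartAt (CModel n) (x : X) x) (ρ x) with hB'
  have hB'c : ∀ x, IsCompact (B' x) := fun x => (isCompact_closedBall _ _).image_of_continuousOn
    ((chartAt (CModel n) (x : X)).continuousOn_symm.mono fun y hy => (hρsub x hy).1)
  have hB'i : ∀ x, B' x ⊆ Ω ∩ E.cover (i x) := by
    rintro x _ ⟨y, hy, rfl⟩
    exact (hρsub x hy).2
  have hBB' : ∀ x, B x ⊆ B' x := fun x y hy => ⟨chartAt (CModel n) (x : X) y,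
    ball_subset_closedBall (ball_subset_ball (by linarith [hρ x]) hy.2),
    (chartAt (CModel n) (x : X)).left_inv hy.1⟩
  obtain ⟨A, hA⟩ := hKc.elim_nhds_subcover' (fun x hx => B ⟨x, hx⟩) fun x hx =>
    inter_mem ((chartAt (CModel n) x).open_source.mem_nhds (mem_chart_source _ x))
      ((chartAt (CModel n) x).continuousAt (mem_chart_source _ x)
        (ball_mem_nhds _ (half_pos (hρ ⟨x, hx⟩))))
  have hKB : ∀ y ∈ K, ∃ a ∈ A, y ∈ B a := fun y hy => by simpa using hA hy
  have hVL : ∀ y ∈ Ω, y ∈ L ∨ ∃ q ∈ T, y ∈ V q := by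
    intro y hy
    by_cases h : y ∈ ⋃ q ∈ T, interior (V q)
    · obtain ⟨q, hq, hyq⟩ := mem_iUnion₂.1 h
      exact Or.inr ⟨q, hq, interior_subset hyq⟩
    · exact Or.inl ⟨subset_closure hy, h⟩
  -- Bounds near the boundary, in the frames given there.
  obtain ⟨C₁, hC₁, h₁⟩ := T.exists_one_le_of_forall
    (P := fun q C => ∀ k, ∀ s ∈ (E.tensorPow k).sections, ∀ M : ℝ, 0 ≤ M →
      (∀ a ∈ A, ∀ y ∈ B a, ‖s (i a) y‖ ≤ M) → ∀ y ∈ V q ∩ Ω, ‖s (ib q) y‖ ≤ max 1 C ^ k * M)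
    (fun q C C' hCC' h k s hs M hM hsM y hy => (h k s hs M hM hsM y hy).trans
      (mul_le_mul_of_nonneg_right (pow_le_pow_left₀ (by positivity)
        (max_le_max_left 1 hCC') k) hM))
    (fun q hq => by
      obtain ⟨C, hC1, hC⟩ := E.exists_norm_le_of_cover A hB'c hB'i hBB' (hKbc q) (hKbi q)
      refine ⟨C, hC1, fun k s hs M hM hsM => ?_⟩
      rw [max_eq_right hC1]
      exact hbound q _ (hs.1 (ib q)) _ (by positivity) fun y hy => hC k s hs M hM hsM y hy
        (hKB y (Or.inr (mem_iUnion₂.2 ⟨q, hq, hy⟩))))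
  rw [max_eq_right hC₁] at h₁
  -- Bounds on the larger balls.
  obtain ⟨C₂, hC₂, h₂⟩ := A.exists_one_le_of_forall
    (P := fun a C => ∀ k, ∀ s ∈ (E.tensorPow k).sections, ∀ M : ℝ, 0 ≤ M →
      (∀ a ∈ A, ∀ y ∈ B a, ‖s (i a) y‖ ≤ M) → ∀ y ∈ B' a, ‖s (i a) y‖ ≤ max 1 C ^ k * M)
    (fun q C C' hCC' h k s hs M hM hsM y hy => (h k s hs M hM hsM y hy).trans
      (mul_le_mul_of_nonneg_right (pow_le_pow_left₀ (by positivity)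
        (max_le_max_left 1 hCC') k) hM))
    (fun a _ => by
      obtain ⟨C, hC1, hC⟩ := E.exists_norm_le_of_cover A hB'c hB'i hBB' (hB'c a) (hB'i a)
      obtain ⟨C', hC'1, hC'⟩ := T.exists_one_le_of_forall
        (P := fun q C => ∀ k, ∀ s ∈ (E.tensorPow k).sections, ∀ y ∈ B' a ∩ V q,
          ‖s (i a) y‖ ≤ max 1 C ^ k * ‖s (ib q) y‖)
        (fun q C C' hCC' h k s hs y hy => (h k s hs y hy).trans
          (mul_le_mul_of_nonneg_right (pow_le_pow_left₀ (by positivity)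
            (max_le_max_left 1 hCC') k) (norm_nonneg _)))
        (fun q _ => by
          obtain ⟨C, hC1, hC⟩ := E.exists_norm_le_of_isCompact ((hB'c a).inter (hVc q))
            (i := ib q) (j := i a)
            fun y hy => ⟨(hB'i a hy.1).1, hVi q hy.2, (hB'i a hy.1).2⟩
          exact ⟨C, hC1, by rwa [max_eq_right hC1]⟩)
      rw [max_eq_right hC'1] at hC'
      -- A point of `B' a` lies in `L`, hence in some `B`, or in some `V q`, where the boundary
      -- bound `C₁` is followed by a change of frame `C'`.
      refine ⟨max C (C' * C₁), le_max_of_le_left hC1, fun k s hs M hM hsM y hy => ?_⟩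
      rcases hVL y (hB'i a hy).1 with hyL | ⟨q, hq, hyq⟩
      · refine (hC k s hs M hM hsM y hy (hKB y (Or.inl hyL))).trans ?_
        gcongr
        exact (le_max_left _ _).trans (le_max_right _ _)
      · calc ‖s (i a) y‖ ≤ C' ^ k * ‖s (ib q) y‖ := hC' q hq k s hs y ⟨hy, hyq⟩
          _ ≤ C' ^ k * (C₁ ^ k * M) := by
            gcongr
            exact h₁ q hq k s hs M hM hsM y ⟨hyq, (hB'i a hy).1⟩
          _ = (C' * C₁) ^ k * M := by rw [mul_pow, mul_assoc]
          _ ≤ _ := by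
            gcongr
            exact (le_max_right _ _).trans (le_max_right _ _))
  rw [max_eq_right hC₂] at h₂
  -- With this `m`, the Schwarz factor `2 ^ (-(m * k))` absorbs `C₂ ^ k`; the extra order in `m * k
  -- + 1` gives the halving. As `k ≥ 1`, `m * k + 1 ≤ (m + 1) * k`, which yields the final constant.
  obtain ⟨m, hm⟩ := pow_unbounded_of_one_lt C₂ (one_lt_two (α := ℝ))
  refine ⟨A.card * ((m : ℝ) + 1) ^ n, fun k hk => ?_⟩
  have hres : ∀ (a : K) (s : (E.tensorPow k).sections),
      DifferentiableOn ℂ (s.1 (i a) ∘ (chartAt (CModel n) (a : X)).symm)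
        (ball (chartAt (CModel n) (a : X) a) (ρ a)) := fun a s =>
    (HolomorphicOn.differentiableOn_comp_chartAt_symm (s.2.1 (i a)) (a : X)).mono
      (ball_subset_closedBall.trans (hρsub a))
  let res : ∀ a : A, (E.tensorPow k).sections →ₗ[ℂ]
      holomorphicSubmodule (ball (chartAt (CModel n) ((a : K) : X) (a : K)) (ρ a)) := fun a =>
    { toFun := fun s => ⟨_, hres a s⟩
      map_add' := fun s t => rfl
      map_smul' := fun c s => rfl }
  let J : (E.tensorPow k).sections →ₗ[ℂ] (A → monomialSpan n (m * k + 1)) :=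
    LinearMap.pi fun a => (jet isOpen_ball (mem_ball_self (hρ a)) (m * k + 1)).comp (res a)
  have hJ : Function.Injective J := by
    rw [← LinearMap.ker_eq_bot, LinearMap.ker_eq_bot']
    intro s hs
    have hhalf : ∀ M : ℝ, 0 ≤ M → (∀ a ∈ A, ∀ y ∈ B a, ‖s.1 (i a) y‖ ≤ M) →
        ∀ a ∈ A, ∀ y ∈ B a, ‖s.1 (i a) y‖ ≤ M / 2 := by
      intro M hM hsM a ha y hy
      have hbig := h₂ a ha k s.1 s.2 M hM hsM
      have hschwarz := norm_le_of_jet_eq_zero (hρ a) (f := res ⟨a, ha⟩ s) (h := m * k)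
        (congrFun hs ⟨a, ha⟩) (M := C₂ ^ k * M)
        (fun z hz => hbig _ (mem_image_of_mem _ (ball_subset_closedBall hz))) hy.2
      have hval : (res ⟨a, ha⟩ s).1 (chartAt (CModel n) (a : X) y) = s.1 (i a) y :=
        congrArg (s.1 (i a)) ((chartAt (CModel n) (a : X)).left_inv hy.1)
      rw [hval] at hschwarz
      refine hschwarz.trans ?_
      have hpow : C₂ ^ k ≤ 2 ^ (m * k) := by
        rw [pow_mul]
        exact pow_le_pow_left₀ (by linarith) hm.le k
      calc C₂ ^ k * M * (1 / 2) ^ (m * k + 1) ≤ 2 ^ (m * k) * M * (1 / 2) ^ (m * k + 1) := by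
            gcongr
        _ = M / 2 := by
            rw [pow_succ, one_div, inv_pow]
            field_simp
    -- The halving needs a finite initial bound, supplied by compactness of the `B' a` in `Ω`.
    obtain ⟨M₀, hM₀1, hM₀⟩ := A.exists_one_le_of_forall
      (P := fun a C => ∀ y ∈ B a, ‖s.1 (i a) y‖ ≤ C)
      (fun a C C' hCC' h y hy => (h y hy).trans hCC') (fun a _ => by
        obtain ⟨C, hC⟩ := (hB'c a).exists_bound_of_continuousOn
          ((s.2.1 (i a)).continuousOn.mono (hB'i a))
        exact ⟨max 1 C, le_max_left _ _,
          fun y hy => (hC y (hBB' a hy)).trans (le_max_right _ _)⟩)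
    have hiter : ∀ l : ℕ, ∀ a ∈ A, ∀ y ∈ B a, ‖s.1 (i a) y‖ ≤ M₀ * (1 / 2) ^ l := by
      intro l
      induction l with
      | zero => simpa using hM₀
      | succ l ih =>
        rw [pow_succ, ← mul_assoc, mul_one_div]
        exact hhalf _ (by positivity) ih
    have hlim : Tendsto (fun l : ℕ => M₀ * (1 / 2 : ℝ) ^ l) atTop (𝓝 0) := by
      have h := tendsto_pow_atTop_nhds_zero_of_lt_one (r := (1 / 2 : ℝ)) (by norm_num) (by norm_num)
      simpa using h.const_mul M₀
    have hzero : ∀ a ∈ A, ∀ y ∈ B a, ‖s.1 (i a) y‖ ≤ 0 := fun a ha y hy =>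
      ge_of_tendsto' hlim fun l => hiter l a ha y hy
    -- Near the boundary, the estimate `h₁` with `M = 0` forces vanishing.
    have hvan : ∀ y ∈ Ω, ∃ j, y ∈ E.cover j ∧ s.1 j y = 0 := by
      intro y hy
      rcases hVL y hy with hyL | ⟨q, hq, hyq⟩
      · obtain ⟨a, ha, hya⟩ := hKB y (Or.inl hyL)
        exact ⟨i a, (hB'i a (hBB' a hya)).2, norm_le_zero_iff.1 (hzero a ha y hya)⟩
      · refine ⟨ib q, hVi q hyq, norm_le_zero_iff.1 ?_⟩
        simpa using h₁ q hq k s.1 s.2 0 le_rfl hzero y ⟨hyq, hy⟩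
    ext j y
    by_cases hy : y ∈ Ω ∩ E.cover j
    · obtain ⟨j', hj', h0⟩ := hvan y hy.1
      rw [s.2.2.1 j' j y ⟨hy.1, hj', hy.2⟩, h0, zero_mul]
      rfl
    · exact s.2.2.2 j y hy
  refine ⟨Module.Finite.of_injective J hJ, ?_⟩
  have hdim : Module.finrank ℂ (E.tensorPow k).sections ≤ A.card * ((m + 1) * k) ^ n := by
    refine (LinearMap.finrank_le_finrank_of_injective hJ).trans ?_
    rw [Module.finrank_pi_fintype, Finset.sum_const, Finset.card_univ, Fintype.card_coe, smul_eq_mul]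
    refine Nat.mul_le_mul_left _ ((finrank_monomialSpan_le n _).trans (Nat.pow_le_pow_left ?_ n))
    rw [add_mul, one_mul]
    omega
  calc (Module.finrank ℂ (E.tensorPow k).sections : ℝ)
      ≤ ((A.card * ((m + 1) * k) ^ n : ℕ) : ℝ) := by exact_mod_cast hdim
    _ = A.card * ((m : ℝ) + 1) ^ n * (k : ℝ) ^ n := by push_cast; rw [mul_pow, mul_assoc]

theorem theorem4p2 {n : ℕ} {X : Type*} [TopologicalSpace X] [T2Space X]
    [ChartedSpace (CModel n) X] [IsManifold 𝓘(ℂ, CModel n) ω X]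
    (Ω : Set X) (hΩ_open : IsOpen Ω) (hΩ_conn : IsConnected Ω)
    (hΩ_compact : IsCompact (closure Ω)) (hΩ_smooth : HasSmoothBoundary n Ω)
    (hΩ_concave : IsAndreottiPseudoconcave n Ω)
    {ι : Type*} (E : ClosureLineBundle n Ω ι) :
    ∃ C : ℝ, ∀ k : ℕ, 1 ≤ k →
      Module.Finite ℂ (E.tensorPow k).sections ∧
        (Module.finrank ℂ (E.tensorPow k).sections : ℝ) ≤ C * (k : ℝ) ^ n := by
  exact E.exists_finrank_sections_le hΩ_open hΩ_compact hΩ_smooth hΩ_concave
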